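/- Definitions. For $n$-tuples $e,e'$ of elements of a linear order, let $t(e,e')\in\{0,1\}^n$ be the tuple whose $i$-th entry is $1$ if and only if $e'_i<e_i$; we say that $e,e'$ realize $t\in\{0,1\}^n$ if $t(e,e')$ is $t$ or $\neg t=\langle 1-t_i\mid i<n\rangle$. For an infinite cardinal $\kappa$ and $n>0$, a linear order $L$ is $(\kappa,n)$-entangled if $|L|\ge\kappa$ and, for every collection $F$ of size $\kappa$ of injective, mutually disjoint $n$-tuples of elements of $L$ and every $t\in\{0,1\}^n$, two distinct elements of $F$ realize $t$. It is $\kappa$-entangled if it is $(\kappa,n)$-entangled for every $n>0$; when $\kappa$ is omitted, $\kappa=\aleph_1$. Sets of reals carry the usual order and the subspace topology. A set $A\subseteq\mathbb R$ is $\kappa$-crowded if $|U\cap A|\ge\kappa$ for every open $U\subseteq\mathbb R$ with $U\cap A\ne\emptyset$. A set $S\subseteq 2^{\omega}$ is monochromatic if the parity of $\Delta(x,y)=\min\{n : x(n)\neq y(n)\}$ is the same for all distinct $x,y\in S$, and $\mathfrak{hm}$ is the least cardinality of a family of monochromatic sets covering $2^{\omega}$. A nontrivial autohomeomorphism of $A$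 is a homeomorphism of $A$ onto itself other than the identity. Theorem. 1. If $\mathfrak{hm}=2^{\aleph_0}$, then there is a $2^{\aleph_0}$-crowded, $2^{\aleph_0}$-entangled set of reals with a nontrivial autohomeomorphism. 2. For every infinite cardinal $\kappa$, if there is a $\kappa$-crowded, $\kappa$-entangled set of reals with a nontrivial autohomeomorphism, then there are two homeomorphic sets of reals $A,B$ such that $A$ is $\kappa$-entangled but $B$ is not $(\kappa,2)$-entangled. 3. Consequently, if $\mathfrak{hm}=2^{\aleph_0}$, then there are two homeomorphic sets of reals $A,B$ such that $A$ is $2^{\aleph_0}$-entangled but $B$ is not $(2^{\aleph_0},2)$-entangled. 4. The continuum hypothesis $2^{\aleph_0}=\aleph_1$ implies $\mathfrak{hm}=2^{\aleph_0}$. 5. Consequently, under the continuum hypothesis, there are two homeomorphic sets of reals $A,B$ such that $A$ is entangled but $B$ is not $2$-entangled; so entangledness is not a topological property. -/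

import Mathlib

open Cardinal

universe u

namespace EntangledOrder

/-- The binary tuple `t(e, e')`: its `i`-th entry is `1` (`true`) iff `e' i < e i`. -/
noncomputable def tupleType {L : Type u} [LinearOrder L] {n : ℕ} (e e' : Fin n → L) : Fin n → Bool :=
  fun i => decide (e' i < e i)

/-- `e` and `e'` realize `t` if `t(e, e')` is `t` or its pointwise negation. -/
def Realize {L : Type u} [LinearOrder L] {n : ℕ} (e e' : Fin n → L) (t : Fin n → Bool) : Prop :=
  tupleType e e' = t ∨ tupleType e e' = fun i => !(t i)

/-- `(κ, n)`-entangled linear orders (used for infinite `κ` and `n > 0`): `|L| ≥ κ`, and for every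
collection `F` of `κ` many injective, mutually disjoint `n`-tuples of `L`, every binary `n`-tuple
is realized by two distinct elements of `F`. -/
def IsEntangledN (κ : Cardinal.{u}) (n : ℕ) (L : Type u) [LinearOrder L] : Prop :=
  κ ≤ #L ∧
    ∀ F : Set (Fin n → L), #F = κ →
      (∀ e ∈ F, Function.Injective e) →
      (∀ e ∈ F, ∀ e' ∈ F, e ≠ e' → Disjoint (Set.range e) (Set.range e')) →
      ∀ t : Fin n → Bool, ∃ e ∈ F, ∃ e' ∈ F, e ≠ e' ∧ Realize e e' t

/-- `κ`-entangled linear orders: `(κ, n)`-entangled for every `n > 0`. -/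
def IsEntangled (κ : Cardinal.{u}) (L : Type u) [LinearOrder L] : Prop :=
  ∀ n : ℕ, 0 < n → IsEntangledN κ n L

/-- `κ`-crowded sets of reals: every open set that meets `A` meets it in at least `κ` points. -/
def IsCrowded (κ : Cardinal.{0}) (A : Set ℝ) : Prop :=
  ∀ U : Set ℝ, IsOpen U → (U ∩ A).Nonempty → κ ≤ #(U ∩ A : Set ℝ)

/-- Monochromatic subsets of the Cantor space: the parity of `Δ(x, y)`, the least `n` with
`x n ≠ y n`, is the same for all pairs of distinct points of `S`. -/
def IsMonochromatic (S : Set (ℕ → Bool)) : Prop :=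
  (∀ x ∈ S, ∀ y ∈ S, x ≠ y → Even (PiNat.firstDiff x y)) ∨
    (∀ x ∈ S, ∀ y ∈ S, x ≠ y → Odd (PiNat.firstDiff x y))

/-- The cardinal invariant `𝔥𝔪`: the least cardinality of a family of monochromatic sets that
covers the Cantor space. -/
noncomputable def hm : Cardinal.{0} :=
  sInf {κ | ∃ C : Set (Set (ℕ → Bool)),
    (∀ S ∈ C, IsMonochromatic S) ∧ ⋃₀ C = Set.univ ∧ #C = κ}

/-- The infimum defining `𝔥𝔪` is attained (the set is nonempty because of the singletons). -/
theorem exists_cover_card_eq_hm : ∃ C : Set (Set (ℕ → Bool)),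
    (∀ S ∈ C, IsMonochromatic S) ∧ ⋃₀ C = Set.univ ∧ #C = hm := by
  refine csInf_mem (s := {κ : Cardinal.{0} | ∃ C : Set (Set (ℕ → Bool)),
    (∀ S ∈ C, IsMonochromatic S) ∧ ⋃₀ C = Set.univ ∧ #C = κ})
    ⟨_, Set.range (fun x : ℕ → Bool => {x}), ?_, ?_, rfl⟩
  · rintro _ ⟨x, rfl⟩
    left
    rintro a rfl b rfl h
    exact absurd rfl h
  · ext x
    simp

end EntangledOrder

namespace EntangledOrder

open Set Topology TopologicalSpace

/-! ### The invariant `hm` -/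

/-! Item 2: a nontrivial autohomeomorphism `h` of `E` moves some piece `X = (a, b) ∩ E` off `(a,
b)`. Then `X ∪ h[X]` lies in `E`, hence is entangled, and it is homeomorphic to `X ∪ (X + (b - a))`,
since both are topological sums of two copies of `X`. The second set is not 2-entangled: a
translation preserves order.

Item 1: let `twist true` flip the odd digits of a point of the Cantor space. It preserves the
lexicographic order of `x, y` when `Δ(x, y)` is even and reverses it when odd, so every
non-monochromatic set contains pairs realizing any order pattern of a point and its twist
(`exists_forall_sLt_twist`). By recursion of length continuum, choose points outside all
monochromatic sections of previously listed closed sets, with earlier points and their twists as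
parameters (`exists_avoiding`); at each stage fewer than `hm` sets are avoided. The chosen points
and their twists form an entangled set, by induction on the coordinates to be controlled
(`exists_forall_sLt`). Restricting to condensation points makes it crowded, and the twist still acts
on it.

Item 4 is the uncountability of `hm` (`aleph0_lt_hm`). -/

theorem hm_le_mk {J : Type} (S : J → Set (ℕ → Bool)) (hS : ∀ j, IsMonochromatic (S j))
    (hcov : ∀ y, ∃ j, y ∈ S j) : hm ≤ #J := by
  refine le_trans (csInf_le' ⟨range S, ?_, ?_, rfl⟩) mk_range_le
  · rintro _ ⟨j, rfl⟩
    exact hS j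
  · ext y
    simpa using hcov y

theorem exists_forall_notMem_of_mk_lt_hm {J : Type} (S : J → Set (ℕ → Bool))
    (hS : ∀ j, IsMonochromatic (S j)) (hJ : #J < hm) : ∃ y, ∀ j, y ∉ S j := by
  by_contra! h
  exact hJ.not_ge (hm_le_mk S hS h)

theorem isMonochromatic_singleton (x : ℕ → Bool) : IsMonochromatic {x} := by
  left
  rintro a rfl b rfl h
  exact absurd rfl h

theorem mk_cantor : #(ℕ → Bool) = continuum := by simp

theorem hm_le_continuum : hm ≤ continuum :=
  mk_cantor ▸ hm_le_mk (fun x => {x}) isMonochromatic_singleton fun y => ⟨y, rfl⟩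

theorem firstDiff_eq {x y : ℕ → Bool} {n : ℕ} (h : ∀ m < n, x m = y m) (hn : x n ≠ y n) :
    PiNat.firstDiff x y = n := by
  have hxy : x ≠ y := fun e => hn (congrFun e n)
  apply le_antisymm
  · by_contra! hlt
    exact hn (PiNat.apply_eq_of_lt_firstDiff hlt)
  · by_contra! hlt
    exact PiNat.apply_firstDiff_ne hxy (h _ hlt)

open Classical in
/-- A point that disagrees at place `n` with some point of `S (n / 2)` having the same first
`n` digits, whenever there is such a point. -/
noncomputable def diagonalPoint (S : ℕ → Set (ℕ → Bool)) (n : ℕ) : Bool :=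
  if h : ∃ y ∈ S (n / 2), ∀ m : Fin n, diagonalPoint S m = y m then !(h.choose n) else false

theorem exists_firstDiff_diagonalPoint {S : ℕ → Set (ℕ → Bool)} {n : ℕ}
    (h : diagonalPoint S ∈ S (n / 2)) :
    ∃ y ∈ S (n / 2), diagonalPoint S ≠ y ∧ PiNat.firstDiff (diagonalPoint S) y = n := by
  have hex : ∃ y ∈ S (n / 2), ∀ m : Fin n, diagonalPoint S m = y m := ⟨_, h, fun _ => rfl⟩
  have hne : diagonalPoint S n ≠ hex.choose n := by
    rw [diagonalPoint, dif_pos hex]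
    simp
  exact ⟨hex.choose, hex.choose_spec.1, fun e => hne (congrFun e n),
    firstDiff_eq (fun m hm => hex.choose_spec.2 ⟨m, hm⟩) hne⟩

/-- Places `2k` and `2k + 1` are both devoted to `S k`. If the diagonal point were in `S k`, it
would first differ from members of `S k` at both places, giving both parities. -/
theorem diagonalPoint_notMem (S : ℕ → Set (ℕ → Bool)) {k : ℕ} (hS : IsMonochromatic (S k)) :
    diagonalPoint S ∉ S k := by
  intro h
  have h0 : 2 * k / 2 = k := by omega
  have h1 : (2 * k + 1) / 2 = k := by omega
  rcases hS with hS | hS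
  · obtain ⟨y, hy, hne, hd⟩ := exists_firstDiff_diagonalPoint (S := S) (n := 2 * k + 1) (by rwa [h1])
    have := hS _ h y (by rwa [h1] at hy) hne
    rw [hd] at this
    grind
  · obtain ⟨y, hy, hne, hd⟩ := exists_firstDiff_diagonalPoint (S := S) (n := 2 * k) (by rwa [h0])
    have := hS _ h y (by rwa [h0] at hy) hne
    rw [hd] at this
    grind

theorem aleph0_lt_hm : ℵ₀ < hm := by
  by_contra! hle
  obtain ⟨C, hC, hcov, hcard⟩ := exists_cover_card_eq_hm
  have hcount : C.Countable := by
    rw [← le_aleph0_iff_set_countable, hcard]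
    exact hle
  have hne : C.Nonempty := by
    by_contra! hemp
    rw [hemp, sUnion_empty] at hcov
    exact empty_ne_univ hcov
  obtain ⟨S, rfl⟩ := hcount.exists_eq_range hne
  have hmem : diagonalPoint S ∈ ⋃₀ range S := hcov ▸ mem_univ _
  obtain ⟨_, ⟨k, rfl⟩, hk⟩ := hmem
  exact diagonalPoint_notMem S (hC _ ⟨k, rfl⟩) hk

theorem hm_eq_continuum_of_continuum_eq_aleph_one (h : continuum.{0} = aleph 1) :
    hm = continuum :=
  le_antisymm hm_le_continuum (h ▸ aleph_one_le_iff.2 aleph0_lt_hm)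

/-! ### Two homeomorphic sets from an autohomeomorphism -/

theorem IsEntangled.mono {κ : Cardinal.{0}} {A E : Set ℝ} (hE : IsEntangled κ E) (hAE : A ⊆ E)
    (hA : κ ≤ #A) : IsEntangled κ A := by
  intro n hn
  refine ⟨hA, fun F hF hinj hdisj t => ?_⟩
  have hι : Function.Injective (inclusion hAE) := inclusion_injective hAE
  have hιn : Function.Injective (fun e : Fin n → A => inclusion hAE ∘ e) := hι.comp_left
  obtain ⟨_, ⟨e, he, rfl⟩, _, ⟨e', he', rfl⟩, hne, hr⟩ :=
    (hE n hn).2 ((fun e => inclusion hAE ∘ e) '' F) (by rw [mk_image_eq hιn, hF])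
      (by rintro _ ⟨e, he, rfl⟩; exact hι.comp (hinj e he))
      (by
        rintro _ ⟨e, he, rfl⟩ _ ⟨e', he', rfl⟩ hne
        rw [range_comp, range_comp]
        exact (disjoint_image_iff hι).2 (hdisj e he e' he' fun h => hne (by rw [h]))) t
  exact ⟨e, he, e', he', fun h => hne (by rw [h]), hr⟩

/-- The pairs `(x, x + (b - a))` are always ordered the same way in both coordinates, so the type
`01` is never realized. The interval bound keeps `X` and its translate disjoint. -/
theorem not_isEntangledN_union_add {κ : Cardinal.{0}} {X : Set ℝ} (hX : κ ≤ #X)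
    {a b : ℝ} (hXab : X ⊆ Ioo a b) :
    ¬ IsEntangledN κ 2 (X ∪ (fun x => x + (b - a)) '' X : Set ℝ) := by
  intro hent
  obtain ⟨Y, hY⟩ := le_mk_iff_exists_set.1 hX
  let f : X → Fin 2 → (X ∪ (fun x => x + (b - a)) '' X : Set ℝ) := fun x =>
    ![⟨x, Or.inl x.2⟩, ⟨x + (b - a), Or.inr ⟨x, x.2, rfl⟩⟩]
  have hf : Function.Injective f := fun x y h => by
    have := congrFun h 0
    simpa [f, Subtype.ext_iff] using this
  have key : ∀ x y : X, (x : ℝ) ≠ y + (b - a) := fun x y h => by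
    have h1 := hXab x.2
    have h2 := hXab y.2
    simp only [mem_Ioo] at h1 h2
    linarith
  obtain ⟨_, ⟨x, -, rfl⟩, _, ⟨y, -, rfl⟩, -, hr⟩ := hent.2 (f '' Y) (by rw [mk_image_eq hf, hY])
    (by
      rintro _ ⟨x, -, rfl⟩ i j hij
      have h1 := key x x
      have hij := congrArg Subtype.val hij
      fin_cases i <;> fin_cases j
      · rfl
      · exact absurd hij h1
      · exact absurd hij.symm h1
      · rfl)
    (by
      rintro _ ⟨x, -, rfl⟩ _ ⟨y, -, rfl⟩ hne
      rw [disjoint_left]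
      rintro _ ⟨i, rfl⟩ ⟨j, hij⟩
      have h1 := key x y
      have h2 := key y x
      have h3 : (x : ℝ) ≠ y := fun h => hne (by rw [Subtype.ext h])
      have hij := congrArg Subtype.val hij
      fin_cases i <;> fin_cases j
      · exact h3 hij.symm
      · exact h1 hij.symm
      · exact h2 hij
      · exact h3 (add_right_cancel hij).symm)
    ![false, true]
  rcases hr with hr | hr
  · have h0 : ¬ f y 0 < f x 0 := decide_eq_false_iff_not.1 (congrFun hr 0)
    have h1 : f y 1 < f x 1 := decide_eq_true_iff.1 (congrFun hr 1)
    exact h0 ((add_lt_add_iff_right (b - a)).1 (show (y : ℝ) + (b - a) < x + (b - a) from h1))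
  · have h0 : f y 0 < f x 0 := decide_eq_true_iff.1 (congrFun hr 0)
    have h1 : ¬ f y 1 < f x 1 := decide_eq_false_iff_not.1 (congrFun hr 1)
    exact h1 ((add_lt_add_iff_right (b - a)).2 (show (y : ℝ) < x from h0))

theorem nonempty_homeomorph_sum {X Y : Set ℝ} (h : SeparatedNhds X Y) :
    Nonempty (X ⊕ Y ≃ₜ (X ∪ Y : Set ℝ)) := by
  have hemb : IsEmbedding (Sum.elim (Subtype.val : X → ℝ) (Subtype.val : Y → ℝ)) :=
    IsEmbedding.subtypeVal.sumElim_of_separatedNhds IsEmbedding.subtypeVal (by simpa using h)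
  exact ⟨hemb.toHomeomorph.trans (Homeomorph.setCongr (by simp))⟩

/-- A moved point and its image have disjoint neighbourhoods; continuity shrinks the first to an
interval that is mapped into the second. -/
theorem exists_separating_Ioo {E : Set ℝ} {h : E ≃ₜ E} (hh : h ≠ Homeomorph.refl E) :
    ∃ a b : ℝ, (Ioo a b ∩ E).Nonempty ∧
      ∃ V : Set ℝ, IsOpen V ∧ Disjoint (Ioo a b) V ∧ ∀ x : E, (x : ℝ) ∈ Ioo a b → (h x : ℝ) ∈ V := by
  obtain ⟨x, hx⟩ : ∃ x, h x ≠ x := by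
    by_contra! hall
    exact hh (Homeomorph.ext hall)
  obtain ⟨U, V, hU, hV, hxU, hxV, hUV⟩ := t2_separation fun e : (x : ℝ) = h x => hx (Subtype.ext e.symm)
  have hc : Continuous fun y : E => (h y : ℝ) := continuous_subtype_val.comp h.continuous
  obtain ⟨W, hW, hWeq⟩ := isOpen_induced_iff.1 (hV.preimage hc)
  have hxW : (x : ℝ) ∈ W := by
    have : x ∈ Subtype.val ⁻¹' W := hWeq ▸ hxV
    exact this
  obtain ⟨a, b, hxab, hab⟩ := mem_nhds_iff_exists_Ioo_subset.1 ((hU.inter hW).mem_nhds ⟨hxU, hxW⟩)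
  refine ⟨a, b, ⟨x, hxab, x.2⟩, V, hV, hUV.mono_left (hab.trans inter_subset_left), ?_⟩
  intro y hy
  have : y ∈ Subtype.val ⁻¹' W := (hab hy).2
  rw [hWeq] at this
  exact this

theorem exists_homeomorph_isEntangled_not_isEntangledN {κ : Cardinal.{0}}
    {E : Set ℝ} (hcr : IsCrowded κ E) (hE : IsEntangled κ E) {h : E ≃ₜ E}
    (hh : h ≠ Homeomorph.refl E) :
    ∃ A B : Set ℝ, Nonempty (A ≃ₜ B) ∧ IsEntangled κ A ∧ ¬ IsEntangledN κ 2 B := by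
  obtain ⟨a, b, hne, V, hV, hdisj, hhV⟩ := exists_separating_Ioo hh
  set X : Set ℝ := Ioo a b ∩ E with hXdef
  have hXab : X ⊆ Ioo a b := inter_subset_left
  have hX : κ ≤ #X := hcr _ isOpen_Ioo hne
  let g : X → ℝ := fun x => h ⟨x, x.2.2⟩
  have hg : IsEmbedding g := (IsEmbedding.subtypeVal.comp h.isEmbedding).comp
    (IsEmbedding.inclusion (inter_subset_right : X ⊆ E))
  have hadd : IsEmbedding (fun x : X => (x : ℝ) + (b - a)) :=
    (Homeomorph.addRight (b - a)).isEmbedding.comp IsEmbedding.subtypeVal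
  have hsep : SeparatedNhds X (range g) :=
    ⟨Ioo a b, V, isOpen_Ioo, hV, hXab, by rintro _ ⟨x, rfl⟩; exact hhV ⟨x, x.2.2⟩ x.2.1, hdisj⟩
  have hsep' : SeparatedNhds X (range fun x : X => (x : ℝ) + (b - a)) := by
    refine ⟨Iio b, Ioi b, isOpen_Iio, isOpen_Ioi, fun x hx => hx.1.2, ?_, ?_⟩
    · rintro _ ⟨x, rfl⟩
      have := x.2.1.1
      simp only [mem_Ioi]
      linarith
    · exact disjoint_left.2 fun x h1 h2 => lt_asymm (mem_Iio.1 h1) h2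
  obtain ⟨f₁⟩ := nonempty_homeomorph_sum hsep
  obtain ⟨f₂⟩ := nonempty_homeomorph_sum hsep'
  refine ⟨X ∪ range g, X ∪ range fun x : X => (x : ℝ) + (b - a), ⟨?_⟩, ?_, ?_⟩
  · exact f₁.symm.trans (((Homeomorph.refl X).sumCongr
      (hg.toHomeomorph.symm.trans hadd.toHomeomorph)).trans f₂)
  · refine hE.mono ?_ (hX.trans (mk_le_mk_of_subset subset_union_left))
    rintro _ (hx | ⟨x, rfl⟩)
    · exact hx.2
    · exact (h _).2
  · have := not_isEntangledN_union_add hX hXab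
    rwa [image_eq_range] at this

/-! ### The lexicographic order on the Cantor space -/

/-- The order-preserving embedding of the lexicographically ordered Cantor space into the line. -/
noncomputable def cantorReal (x : ℕ → Bool) : ℝ := cantorFunction (1 / 3) x

theorem cantorReal_injective : Function.Injective cantorReal :=
  cantorFunction_injective (by norm_num) (by norm_num)

theorem continuous_cantorReal : Continuous cantorReal := by
  refine continuous_tsum (u := fun n => (1 / 3 : ℝ) ^ n) (fun n => ?_)
    (summable_geometric_of_lt_one (by norm_num) (by norm_num)) fun n x => ?_
  · have : Continuous fun b : Bool => (cond b ((1 / 3 : ℝ) ^ n) 0 : ℝ) := continuous_of_discreteTopology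
    exact this.comp (continuous_apply n)
  · cases h : x n <;> simp [cantorFunctionAux, h]

theorem isEmbedding_cantorReal : IsEmbedding cantorReal :=
  (continuous_cantorReal.isClosedEmbedding cantorReal_injective).isEmbedding

theorem cantorReal_lt_iff {x y : ℕ → Bool} (h : x ≠ y) :
    cantorReal x < cantorReal y ↔ x (PiNat.firstDiff x y) = false := by
  have hne := PiNat.apply_firstDiff_ne h
  cases hx : x (PiNat.firstDiff x y)
  · have hy : y (PiNat.firstDiff x y) = true := by grind
    exact iff_of_true (increasing_cantorFunction (by norm_num) (by norm_num)
      (fun k hk => PiNat.apply_eq_of_lt_firstDiff hk) hx hy) rfl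
  · have hy : y (PiNat.firstDiff x y) = false := by grind
    exact iff_of_false (increasing_cantorFunction (by norm_num) (by norm_num)
      (fun k hk => (PiNat.apply_eq_of_lt_firstDiff hk).symm) hy hx).le.not_gt (by simp)

/-- `twist false` is the identity and `twist true` flips all digits at odd places. -/
def twist (b : Bool) (x : ℕ → Bool) : ℕ → Bool := fun n => xor (x n) (b && decide (Odd n))

@[simp]
theorem twist_false (x : ℕ → Bool) : twist false x = x := by
  ext n
  simp [twist]

theorem twist_twist (b c : Bool) (x : ℕ → Bool) : twist b (twist c x) = twist (xor b c) x := by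
  ext n
  simp only [twist]
  cases b <;> cases c <;> simp

theorem twist_true_ne (x : ℕ → Bool) : twist true x ≠ x := fun h => by
  have := congrFun h 1
  simp [twist] at this

theorem twist_injective (b : Bool) : Function.Injective (twist b) := fun x y h => by
  have := congrArg (twist b) h
  simpa [twist_twist] using this

theorem continuous_twist (b : Bool) : Continuous (twist b) :=
  continuous_pi fun n =>
    (continuous_of_discreteTopology (f := fun c : Bool => xor c (b && decide (Odd n)))).comp
      (continuous_apply n)

theorem firstDiff_twist (b : Bool) {x y : ℕ → Bool} (h : x ≠ y) :
    PiNat.firstDiff (twist b x) (twist b y) = PiNat.firstDiff x y :=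
  firstDiff_eq (fun m hm => by simp [twist, PiNat.apply_eq_of_lt_firstDiff hm])
    (by simpa [twist] using PiNat.apply_firstDiff_ne h)

/-- The strict order of the Cantor space, or its reverse if `c` is `true`. -/
def SLt (c : Bool) (x y : ℕ → Bool) : Prop :=
  if c then cantorReal y < cantorReal x else cantorReal x < cantorReal y

theorem SLt.ne {c : Bool} {x y : ℕ → Bool} (h : SLt c x y) : x ≠ y := by
  rintro rfl
  cases c <;> simp [SLt] at h

theorem sLt_iff {c : Bool} {x y : ℕ → Bool} (h : x ≠ y) :
    SLt c x y ↔ x (PiNat.firstDiff x y) = c := by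
  cases c
  · simpa [SLt] using cantorReal_lt_iff h
  · have hne := PiNat.apply_firstDiff_ne h
    have := cantorReal_lt_iff h.symm
    rw [PiNat.firstDiff_comm] at this
    simp only [SLt, if_true, this]
    grind

theorem sLt_twist_iff {b c : Bool} {x y : ℕ → Bool} (h : x ≠ y) :
    SLt c (twist b x) (twist b y) ↔
      x (PiNat.firstDiff x y) = xor c (b && decide (Odd (PiNat.firstDiff x y))) := by
  rw [sLt_iff ((twist_injective b).ne h), firstDiff_twist b h]
  simp only [twist]
  generalize x (PiNat.firstDiff x y) = a, decide (Odd (PiNat.firstDiff x y)) = o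
  clear h
  revert a b c o
  decide

theorem isOpen_setOf_sLt {ι : Type*} (c : Bool) (i : ι) :
    IsOpen {p : (ι → ℕ → Bool) × (ι → ℕ → Bool) | SLt c (p.1 i) (p.2 i)} := by
  have h1 : Continuous fun p : (ι → ℕ → Bool) × (ι → ℕ → Bool) => cantorReal (p.1 i) :=
    continuous_cantorReal.comp ((continuous_apply i).comp continuous_fst)
  have h2 : Continuous fun p : (ι → ℕ → Bool) × (ι → ℕ → Bool) => cantorReal (p.2 i) :=
    continuous_cantorReal.comp ((continuous_apply i).comp continuous_snd)
  cases c
  · simpa [SLt] using isOpen_lt h1 h2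
  · simpa [SLt] using isOpen_lt h2 h1

/-- A rational number strictly separates `x` from `y` in the order `SLt c`. -/
def Separates (c : Bool) (x : ℕ → Bool) (q : ℚ) (y : ℕ → Bool) : Prop :=
  if c then cantorReal y < q ∧ q < cantorReal x else cantorReal x < q ∧ q < cantorReal y

theorem SLt.exists_separates {c : Bool} {x y : ℕ → Bool} (h : SLt c x y) :
    ∃ q, Separates c x q y := by
  cases c
  · simpa [Separates] using exists_rat_btwn (by simpa [SLt] using h)
  · simpa [Separates] using exists_rat_btwn (by simpa [SLt] using h)

/-- Sharing the rational lets the left point of one pair be compared with the right point of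
another. -/
theorem Separates.sLt {c : Bool} {x x' y y' : ℕ → Bool} {q : ℚ} (h : Separates c x q y)
    (h' : Separates c x' q y') : SLt c x y' := by
  cases c
  · simp only [Separates, Bool.false_eq_true, if_false] at h h'
    simpa [SLt] using h.1.trans h'.2
  · simp only [Separates, if_true] at h h'
    simpa [SLt] using h'.1.trans h.2

theorem exists_forall_sLt_twist {S : Set (ℕ → Bool)} (hS : ¬ IsMonochromatic S) (t : Bool → Bool) :
    ∃ x ∈ S, ∃ y ∈ S, ∀ b, SLt (t b) (twist b x) (twist b y) := by
  simp only [IsMonochromatic, not_or, not_forall] at hS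
  obtain ⟨⟨x, hx, y, hy, hne, hd⟩, x', hx', y', hy', hne', hd'⟩ := hS
  -- The twist must reverse the pair exactly when `t false ≠ t true`, which fixes the parity of `Δ`;
  -- exchanging `x` and `y` then adjusts the direction.
  obtain ⟨x, hx, y, hy, hne, hd⟩ : ∃ x ∈ S, ∃ y ∈ S, x ≠ y ∧
      xor (t false) (t true) = decide (Odd (PiNat.firstDiff x y)) := by
    cases h : xor (t false) (t true)
    · exact ⟨x', hx', y', hy', hne', by simpa using hd'⟩
    · exact ⟨x, hx, y, hy, hne, by simpa using hd⟩
  have hb : ∀ u v w a : Bool, xor u v = w → a = u →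
      ∀ b, a = xor (cond b v u) (b && w) := by decide
  have h3 : ∀ a b c : Bool, a ≠ c → a ≠ b → b = c := by decide
  have ht : ∀ b, t b = cond b (t true) (t false) := by simp
  by_cases h : x (PiNat.firstDiff x y) = t false
  · refine ⟨x, hx, y, hy, fun b => (sLt_twist_iff hne).2 ?_⟩
    rw [ht b]
    exact hb _ _ _ _ hd h b
  · refine ⟨y, hy, x, hx, fun b => (sLt_twist_iff hne.symm).2 ?_⟩
    have := PiNat.apply_firstDiff_ne hne
    rw [PiNat.firstDiff_comm, ht b]
    exact hb _ _ _ _ hd (h3 _ _ _ h this) b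

/-! ### The transfinite construction -/

theorem exists_forall_restrict {ι : Type} [LinearOrder ι] [WellFoundedLT ι] {Y : Type}
    (P : ∀ a : ι, (Iio a → Y) → Y → Prop) (hP : ∀ a f, ∃ y, P a f y) :
    ∃ x : ι → Y, ∀ a, P a (fun c => x c) (x a) := by
  choose g hg using hP
  let x : ι → Y := WellFounded.fix (wellFounded_lt (α := ι)) fun a ih => g a fun c => ih c c.2
  refine ⟨x, fun a => ?_⟩
  have : x a = g a fun c => x c := WellFounded.fix_eq _ _ _
  rw [this]
  exact hg _ _

/-- The points of the Cantor space given by a sequence `x` and its image under `twist true`. -/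
def twistPair {ι : Type} (x : ι → ℕ → Bool) (p : ι × Bool) : ℕ → Bool := twist p.2 (x p.1)

/-- The tuple with pattern `p`, in which the entries are either twists of terms of the sequence `x`
or twists of `y`. -/
def patternTuple {ι : Type} (x : ι → ℕ → Bool) {n : ℕ} (p : Fin n → (ι × Bool) ⊕ Bool)
    (y : ℕ → Bool) : Fin n → ℕ → Bool :=
  fun i => Sum.elim (twistPair x) (fun b => twist b y) (p i)

theorem exists_avoiding {ι : Type} [LinearOrder ι] [WellFoundedLT ι] 
    (hlt : ∀ a : ι, #(Iio a) < hm) (K : ι → Σ n, Set (Fin n → ℕ → Bool)) :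
    ∃ x : ι → ℕ → Bool, ∀ a, (∀ c < a, ∀ b, x a ≠ twist b (x c)) ∧
      ∀ c < a, ∀ p : Fin (K c).1 → (Iio a × Bool) ⊕ Bool,
        IsMonochromatic {y | patternTuple (fun d : Iio a => x d) p y ∈ (K c).2} →
        patternTuple (fun d : Iio a => x d) p (x a) ∉ (K c).2 := by
  refine exists_forall_restrict (fun a f y => (∀ c, ∀ h : c < a, ∀ b, y ≠ twist b (f ⟨c, h⟩)) ∧
      ∀ c < a, ∀ p : Fin (K c).1 → (Iio a × Bool) ⊕ Bool,
        IsMonochromatic {y | patternTuple f p y ∈ (K c).2} → patternTuple f p y ∉ (K c).2) ?_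
  have hι : ℵ₀ ≤ hm := aleph0_lt_hm.le
  intro a f
  let J : Type := (Σ c : Iio a, Fin (K c).1 → (Iio a × Bool) ⊕ Bool) ⊕ (Iio a × Bool)
  let T : (Σ c : Iio a, Fin (K c).1 → (Iio a × Bool) ⊕ Bool) → Set (ℕ → Bool) := fun j =>
    -- The second conjunct makes the set empty unless the section is monochromatic.
    {y | patternTuple f j.2 y ∈ (K j.1).2 ∧ IsMonochromatic {y | patternTuple f j.2 y ∈ (K j.1).2}}
  let S : J → Set (ℕ → Bool) := Sum.elim T (fun q => {twistPair f q})
  have hS : ∀ j, IsMonochromatic (S j) := by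
    rintro (j | q)
    · by_cases hm : IsMonochromatic {y | patternTuple f j.2 y ∈ (K j.1).2}
      · exact hm.imp (fun h x hx y hy => h x hx.1 y hy.1) (fun h x hx y hy => h x hx.1 y hy.1)
      · exact Or.inl fun x hx => absurd hx.2 hm
    · exact isMonochromatic_singleton _
  have hp : #(Iio a × Bool) < hm := by
    rw [mk_prod, lift_id, lift_id]
    exact mul_lt_of_lt hι (hlt a) ((mk_lt_aleph0 (α := Bool)).trans_le hι)
  have hq : #((Iio a × Bool) ⊕ Bool) < hm := by
    rw [mk_sum, lift_id, lift_id]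
    exact add_lt_of_lt hι hp ((mk_lt_aleph0 (α := Bool)).trans_le hι)
  have hl : #(List ((Iio a × Bool) ⊕ Bool)) < hm :=
    (mk_list_le_max _).trans_lt (max_lt aleph0_lt_hm hq)
  have hs : #(Σ c : Iio a, Fin (K c).1 → (Iio a × Bool) ⊕ Bool) < hm := by
    refine lt_of_le_of_lt (mk_le_of_injective
      (f := fun j : (Σ c : Iio a, Fin (K c).1 → (Iio a × Bool) ⊕ Bool) =>
        (j.1, List.ofFn j.2)) ?_) ((mk_prod _ _).trans_lt ?_)
    · rintro ⟨c, p⟩ ⟨c', p'⟩ h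
      simp only [Prod.mk.injEq] at h
      obtain ⟨rfl, h⟩ := h
      rw [List.ofFn_injective h]
    · rw [lift_id, lift_id]
      exact mul_lt_of_lt hι (hlt a) hl
  have hJ : #J < hm := by
    rw [mk_sum, lift_id, lift_id]
    exact add_lt_of_lt hι hs hp
  obtain ⟨y, hy⟩ := exists_forall_notMem_of_mk_lt_hm S hS hJ
  exact ⟨y, fun c h b => hy (Sum.inr (⟨c, h⟩, b)),
    fun c h p hmono hmem => hy (Sum.inl ⟨⟨c, h⟩, p⟩) ⟨hmem, hmono⟩⟩

/-- König's theorem; it makes countable pigeonholing possible even when the continuum is singular.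
-/
theorem mk_lt_cof_continuum {α : Type} [Countable α] : #α < continuum.{0}.ord.cof := by
  refine (mk_le_aleph0 (α := α)).trans_lt ?_
  rw [← two_power_aleph0]
  exact lt_cof_ord_power le_rfl (by norm_num)

/-- Freeze the entries of index below the top index `a` and let those at `a` vary. The section
contains `x a`, so by the avoidance property it is not monochromatic. -/
theorem exists_sLt_of_code {ι : Type} [LinearOrder ι] {K : ι → Σ n, Set (Fin n → ℕ → Bool)}
    {x : ι → ℕ → Bool} {a c : ι}
    (hx : ∀ p : Fin (K c).1 → (Iio a × Bool) ⊕ Bool,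
      IsMonochromatic {y | patternTuple (fun d : Iio a => x d) p y ∈ (K c).2} →
      patternTuple (fun d : Iio a => x d) p (x a) ∉ (K c).2)
    {n : ℕ} {s : Finset (Fin n)} {C : Set (s → ℕ → Bool)} (hK : K c = ⟨n, s.restrict ⁻¹' C⟩)
    {e : Fin n → ι × Bool} (he : Function.Injective e) (hea : ∀ i ∈ s, (e i).1 ≤ a)
    (heC : (fun i : s => twistPair x (e i)) ∈ C) (t : Fin n → Bool) :
    ∃ k ∈ C, ∃ k' ∈ C, ∀ i : s, if (e i).1 = a then SLt (t i) (k i) (k' i) else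
      k i = twistPair x (e i) ∧ k' i = twistPair x (e i) := by
  classical
  rw [hK] at hx
  let p : Fin n → (Iio a × Bool) ⊕ Bool := fun i =>
    if h : (e i).1 < a then Sum.inl (⟨(e i).1, h⟩, (e i).2) else Sum.inr (e i).2
  have hlt : ∀ i, (e i).1 < a → ∀ y,
      patternTuple (fun d : Iio a => x d) p y i = twistPair x (e i) := fun i h y => by
    simp [patternTuple, p, h, twistPair]
  have heq : ∀ i, (e i).1 = a → ∀ y,
      patternTuple (fun d : Iio a => x d) p y i = twist (e i).2 y := fun i h y => by
    simp [patternTuple, p, h]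
  have hmem : patternTuple (fun d : Iio a => x d) p (x a) ∈ s.restrict ⁻¹' C := by
    have : s.restrict (patternTuple (fun d : Iio a => x d) p (x a)) =
        fun i : s => twistPair x (e i) := by
      ext1 i
      rcases (hea i i.2).lt_or_eq with h | h
      · exact hlt i h _
      · exact (heq i h _).trans (by rw [twistPair, h])
    rwa [mem_preimage, this]
  have hmono := fun h => hx p h hmem
  -- Injectivity of `e` means that each twist of the point at `a` occurs at most once, so the
  -- required orders cannot conflict.
  obtain ⟨y, hy, y', hy', hyy'⟩ := exists_forall_sLt_twist hmono
    fun b => decide (∃ i, e i = (a, b) ∧ t i = true)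
  refine ⟨_, hy, _, hy', fun i => ?_⟩
  split_ifs with h
  · have hb := hyy' (e i).2
    have ht : decide (∃ j, e j = (a, (e i).2) ∧ t j = true) = t i := by
      have hei : e i = (a, (e i).2) := by rw [← h]
      have : (∃ j, e j = (a, (e i).2) ∧ t j = true) ↔ t i = true :=
        ⟨fun ⟨j, hj, htj⟩ => he (hj.trans hei.symm) ▸ htj, fun hti => ⟨i, hei, hti⟩⟩
      simp [this]
    rw [ht] at hb
    simpa only [Finset.restrict, heq i h] using hb
  · have h := (hea i i.2).lt_of_ne h
    exact ⟨hlt i h _, hlt i h _⟩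

theorem exists_forall_sLt {ι : Type} [LinearOrder ι] (hι : ∀ a : ι, #(Iic a) < continuum)
    {K : ι → Σ n, Set (Fin n → ℕ → Bool)}
    (hK : ∀ n (C : Set (Fin n → ℕ → Bool)), IsClosed C → ∃ c, K c = ⟨n, C⟩)
    {x : ι → ℕ → Bool} (hx : ∀ a, ∀ c < a, ∀ p : Fin (K c).1 → (Iio a × Bool) ⊕ Bool,
      IsMonochromatic {y | patternTuple (fun d : Iio a => x d) p y ∈ (K c).2} →
      patternTuple (fun d : Iio a => x d) p (x a) ∉ (K c).2)
    {n : ℕ} (t : Fin n → Bool) {F : Set (Fin n → ι × Bool)}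
    (hinj : ∀ e ∈ F, Function.Injective e)
    (hdisj : ∀ e ∈ F, ∀ e' ∈ F, e ≠ e' → Disjoint (range e) (range e'))
    (s : Finset (Fin n)) : ∀ I ⊆ F, continuum ≤ #I → ∃ e ∈ I, ∃ e' ∈ I, e ≠ e' ∧
      ∀ i ∈ s, SLt (t i) (twistPair x (e i)) (twistPair x (e' i)) := by
  classical
  induction s using Finset.strongInduction with
  | H s ih =>
  intro I hIF hI
  rcases s.eq_empty_or_nonempty with rfl | ⟨i₀, hi₀⟩
  · have : 1 < #I := one_lt_aleph0.trans_le (aleph0_le_continuum.trans hI)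
    obtain ⟨e, e', hne⟩ := one_lt_iff_nontrivial.1 this
    exact ⟨e, e.2, e', e'.2, fun h => hne (Subtype.ext h), by simp⟩
  let A : Set (s → ℕ → Bool) := (fun e (i : s) => twistPair x (e i)) '' I
  obtain ⟨c, hc⟩ := hK n (s.restrict ⁻¹' closure A)
    (isClosed_closure.preimage (Finset.continuous_restrict s))
  -- Few members of `I` have their `i₀`-th index at most `c`.
  let I₁ : Set (Fin n → ι × Bool) := {e ∈ I | c < (e i₀).1}
  have hI₁ : continuum ≤ #I₁ := by
    by_contra! hlt
    have hsmall : #{e ∈ I | ¬ c < (e i₀).1} < continuum := by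
      have hle : #{e ∈ I | ¬ c < (e i₀).1} ≤ #(Iic c × Bool) := by
        refine mk_le_of_injective
          (f := fun e => (⟨(e.1 i₀).1, not_lt.1 e.2.2⟩, (e.1 i₀).2)) fun e e' h => ?_
        by_contra hne
        have h1 := congrArg Subtype.val (congrArg Prod.fst h)
        have h2 := congrArg Prod.snd h
        exact disjoint_left.1 (hdisj _ (hIF e.2.1) _ (hIF e'.2.1) fun h => hne (Subtype.ext h))
          ⟨i₀, rfl⟩ ⟨i₀, (Prod.ext h1 h2).symm⟩
      refine hle.trans_lt ?_
      rw [mk_prod, lift_id, lift_id]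
      exact mul_lt_of_lt aleph0_le_continuum (hι c) ((mk_lt_aleph0 (α := Bool)).trans_le
        aleph0_le_continuum)
    have hun : I = I₁ ∪ {e ∈ I | ¬ c < (e i₀).1} := by
      ext e
      by_cases h : c < (e i₀).1 <;> simp [I₁, h, not_lt.1]
    rw [hun] at hI
    exact absurd hI ((mk_union_le _ _).trans_lt (add_lt_of_lt aleph0_le_continuum hlt hsmall)).not_ge
  -- `r.1` is the set of coordinates in `s` of top index, and `r.2` holds rationals witnessing the
  -- required order there; the other coordinates of `s` are unchanged.
  have hsep : ∀ e : I₁, ∃ r : Finset (Fin n) × (Fin n → ℚ), r.1 ⊆ s ∧ r.1.Nonempty ∧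
      ∃ k ∈ closure A, ∃ k' ∈ closure A, ∀ i : s,
        if (i : Fin n) ∈ r.1 then Separates (t i) (k i) (r.2 i) (k' i) else
          k i = twistPair x (e.1 i) ∧ k' i = twistPair x (e.1 i) := by
    intro e
    obtain ⟨j, hj, hmax⟩ := s.exists_max_image (fun i => (e.1 i).1) ⟨i₀, hi₀⟩
    obtain ⟨k, hk, k', hk', hkk⟩ := exists_sLt_of_code
      (hx _ _ (e.2.2.trans_le (hmax i₀ hi₀))) hc (hinj _ (hIF e.2.1)) hmax
      (subset_closure ⟨e, e.2.1, rfl⟩) t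
    have hq : ∀ i : Fin n, ∃ q : ℚ, ∀ h : i ∈ s, (e.1 i).1 = (e.1 j).1 →
        Separates (t i) (k ⟨i, h⟩) q (k' ⟨i, h⟩) := by
      intro i
      by_cases h : i ∈ s ∧ (e.1 i).1 = (e.1 j).1
      · have := hkk ⟨i, h.1⟩
        rw [if_pos h.2] at this
        exact this.exists_separates.imp fun q hq _ _ => hq
      · exact ⟨0, fun h1 h2 => absurd ⟨h1, h2⟩ h⟩
    choose q hq using hq
    refine ⟨({i ∈ s | (e.1 i).1 = (e.1 j).1}, q), Finset.filter_subset _ _, ⟨j, by simp [hj]⟩,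
      k, hk, k', hk', fun i => ?_⟩
    have := hkk i
    split_ifs with h
    · exact hq i i.2 (Finset.mem_filter.1 h).2
    · rwa [if_neg fun h' => h (Finset.mem_filter.2 ⟨i.2, h'⟩)] at this
  choose r hrs hr k hk k' hk' hkk using hsep
  obtain ⟨⟨T, q⟩, I₂, hI₂, hcard, hI₂r⟩ :=
    infinite_pigeonhole_set r continuum hI₁ aleph0_le_continuum mk_lt_cof_continuum
  have hne₂ : I₂.Nonempty :=
    mk_set_ne_zero_iff.1 (aleph0_pos.trans_le (aleph0_le_continuum.trans hcard)).ne'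
  have hTs : T ⊆ s ∧ T.Nonempty := by
    obtain ⟨e, he⟩ := hne₂
    have h1 := hrs ⟨e, hI₂ he⟩
    have h2 := hr ⟨e, hI₂ he⟩
    rw [hI₂r he] at h1 h2
    exact ⟨h1, h2⟩
  -- The left point built from `e` and the right point built from `e'` are in the right order on all
  -- of `s`: on `T` by the common rationals, elsewhere by induction. The order conditions are open,
  -- so nearby actual members of `A` satisfy them too.
  obtain ⟨e, he, e', he', -, hlt⟩ := ih (s \ T) (Finset.sdiff_ssubset hTs.1 hTs.2) I₂
    (hI₂.trans ((sep_subset _ _).trans hIF)) hcard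
  let O : Set ((s → ℕ → Bool) × (s → ℕ → Bool)) := ⋂ i : s, {p | SLt (t i) (p.1 i) (p.2 i)}
  have hO : IsOpen O := isOpen_iInter_of_finite fun i => isOpen_setOf_sLt (t i) i
  have hmemO : (k ⟨e, hI₂ he⟩, k' ⟨e', hI₂ he'⟩) ∈ O := by
    refine mem_iInter.2 fun i => ?_
    have h1 := hkk ⟨e, hI₂ he⟩ i
    have h2 := hkk ⟨e', hI₂ he'⟩ i
    rw [hI₂r he] at h1
    rw [hI₂r he'] at h2
    by_cases hi : (i : Fin n) ∈ T
    · rw [if_pos hi] at h1 h2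
      exact h1.sLt h2
    · rw [if_neg hi] at h1 h2
      have := hlt i (Finset.mem_sdiff.2 ⟨i.2, hi⟩)
      rwa [← h1.1, ← h2.2] at this
  have hcl : (k ⟨e, hI₂ he⟩, k' ⟨e', hI₂ he'⟩) ∈ closure (A ×ˢ A) := by
    rw [closure_prod_eq]
    exact ⟨hk _, hk' _⟩
  obtain ⟨⟨_, _⟩, hgO, ⟨d, hd, rfl⟩, d', hd', rfl⟩ := mem_closure_iff.1 hcl O hO hmemO
  have hdd : ∀ i ∈ s, SLt (t i) (twistPair x (d i)) (twistPair x (d' i)) := fun i hi =>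
    mem_iInter.1 hgO ⟨i, hi⟩
  refine ⟨d, hd, d', hd', ?_, hdd⟩
  rintro rfl
  exact (hdd i₀ hi₀).ne rfl

theorem mk_isClosed_le_continuum (Y : Type) [TopologicalSpace Y] [SecondCountableTopology Y] :
    #{C : Set Y // IsClosed C} ≤ continuum := by
  let f : {C : Set Y // IsClosed C} → Set (countableBasis Y) := fun C => {b | Disjoint b.1 C.1}
  have hsub : ∀ C D, f C = f D → D.1 ⊆ C.1 := by
    intro C D h y hy
    by_contra hyC
    obtain ⟨b, hb, hyb, hbC⟩ := (isBasis_countableBasis Y).exists_subset_of_mem_open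
      (show y ∈ C.1ᶜ from hyC) C.2.isOpen_compl
    have : (⟨b, hb⟩ : countableBasis Y) ∈ f D := h ▸ disjoint_left.2 hbC
    exact disjoint_left.1 this hyb hy
  have hf : Function.Injective f := fun C D h =>
    Subtype.ext ((hsub D C h.symm).antisymm (hsub C D h))
  refine (mk_le_of_injective hf).trans ?_
  rw [mk_set, ← two_power_aleph0]
  exact power_le_power_left two_ne_zero (le_aleph0_iff_set_countable.2 (countable_countableBasis Y))

theorem exists_closed_enumeration {ι : Type} (hι : #ι = continuum) :
    ∃ K : ι → Σ n, Set (Fin n → ℕ → Bool),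
      ∀ n (C : Set (Fin n → ℕ → Bool)), IsClosed C → ∃ c, K c = ⟨n, C⟩ := by
  let Z : Type := Σ n, {C : Set (Fin n → ℕ → Bool) // IsClosed C}
  have hZ : #Z ≤ #ι := by
    rw [mk_sigma, hι]
    refine (sum_le_sum _ _ fun n => mk_isClosed_le_continuum (Fin n → ℕ → Bool)).trans ?_
    simp
  have : Nonempty Z := ⟨⟨0, ∅, isClosed_empty⟩⟩
  obtain ⟨f⟩ := hZ
  refine ⟨fun c => ⟨(Function.invFun f c).1, (Function.invFun f c).2.1⟩, fun n C hC => ?_⟩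
  exact ⟨f ⟨n, C, hC⟩, congrArg (fun z : Z => (⟨z.1, z.2.1⟩ : Σ n, Set (Fin n → ℕ → Bool)))
    (Function.leftInverse_invFun f.injective ⟨n, C, hC⟩)⟩

theorem twistPair_injective {ι : Type} [LinearOrder ι] {x : ι → ℕ → Bool}
    (hx : ∀ a, ∀ c < a, ∀ b, x a ≠ twist b (x c)) : Function.Injective (twistPair x) := by
  have key : ∀ a c b b', c < a → twist b (x a) ≠ twist b' (x c) := fun a c b b' hca h => by
    apply hx a c hca (xor b b')
    rw [← twist_twist, ← h, twist_twist]
    simp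
  rintro ⟨a, b⟩ ⟨c, b'⟩ h
  simp only [twistPair] at h
  rcases lt_trichotomy a c with hac | rfl | hac
  · exact absurd h.symm (key _ _ _ _ hac)
  · have h1 := twist_true_ne (x a)
    cases b <;> cases b' <;> simp_all [eq_comm]
  · exact absurd h (key _ _ _ _ hac)

/-! ### The entangled set -/

/-- Entangledness is given for all large subsets because crowdedness is obtained by discarding
points. -/
theorem exists_isEntangled_of_hm_eq_continuum (h : hm = continuum) :
    ∃ X : Set (ℕ → Bool), continuum ≤ #X ∧ (∀ y ∈ X, twist true y ∈ X) ∧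
      ∀ E : Set ℝ, E ⊆ cantorReal '' X → continuum ≤ #E → IsEntangled continuum E := by
  let ι : Type := continuum.{0}.ord.ToType
  have hι : #ι = continuum := mk_ord_toType _
  have hIio : ∀ a : ι, #(Iio a) < continuum := fun a =>
    (mk_Iio_lt a (by rw [hι, Ordinal.type_toType])).trans_eq hι
  have hIic : ∀ a : ι, #(Iic a) < continuum := fun a => by
    rw [← Iio_insert]
    exact (mk_insert_le).trans_lt (add_lt_of_lt aleph0_le_continuum (hIio a)
      (one_lt_aleph0.trans_le aleph0_le_continuum))
  obtain ⟨K, hK⟩ := exists_closed_enumeration hι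
  obtain ⟨x, hx⟩ := exists_avoiding (fun a => (hIio a).trans_eq h.symm) K
  have hinjx : Function.Injective (twistPair x) := twistPair_injective fun a => (hx a).1
  refine ⟨range (twistPair x), ?_, ?_, ?_⟩
  · rw [mk_range_eq _ hinjx, mk_prod, lift_id, lift_id, hι]
    exact le_mul_right (mk_ne_zero _)
  · rintro _ ⟨⟨a, b⟩, rfl⟩
    exact ⟨(a, xor true b), by simp only [twistPair, twist_twist]⟩
  intro E hEX hE n _
  refine ⟨hE, fun F hF hinj hdisj t => ?_⟩
  have hg : ∀ z : E, ∃ p, cantorReal (twistPair x p) = z := fun z => by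
    obtain ⟨_, ⟨p, rfl⟩, hp⟩ := hEX z.2
    exact ⟨p, hp⟩
  choose g hg using hg
  have hginj : Function.Injective g := fun z z' hz => Subtype.ext (by rw [← hg, ← hg, hz])
  have hginj' : Function.Injective fun e : Fin n → E => g ∘ e := hginj.comp_left
  obtain ⟨_, ⟨e, he, rfl⟩, _, ⟨e', he', rfl⟩, hne, hlt⟩ :=
    exists_forall_sLt hIic hK (fun a => (hx a).2) t (F := (fun e => g ∘ e) '' F)
      (by rintro _ ⟨e, he, rfl⟩; exact hginj.comp (hinj e he))
      (by
        rintro _ ⟨e, he, rfl⟩ _ ⟨e', he', rfl⟩ hne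
        rw [range_comp, range_comp]
        exact (disjoint_image_iff hginj).2 (hdisj e he e' he' fun h => hne (by rw [h])))
      Finset.univ _ subset_rfl (by rw [mk_image_eq hginj', hF])
  refine ⟨e, he, e', he', fun h => hne (by rw [h]), Or.inl (funext fun i => ?_)⟩
  have := hlt i (Finset.mem_univ i)
  simp only [SLt, Function.comp_apply, hg] at this
  cases hti : t i
  · rw [hti] at this
    exact decide_eq_false (lt_asymm (show e i < e' i from this))
  · rw [hti] at this
    exact decide_eq_true (show e' i < e i from this)

/-- The points of `X` all of whose neighbourhoods contain continuum many points of `X`. -/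
def condensationPoints {Y : Type} [TopologicalSpace Y] (X : Set Y) : Set Y :=
  {y ∈ X | ∀ U, IsOpen U → y ∈ U → continuum ≤ #(U ∩ X : Set Y)}

/-- Each discarded point has a basic neighbourhood meeting `X` in fewer than continuum many points;
continuum many discarded points would yield continuum many sharing one such neighbourhood. -/
theorem mk_diff_condensationPoints_lt {Y : Type} [TopologicalSpace Y] [SecondCountableTopology Y]
    (X : Set Y) : #(X \ condensationPoints X : Set Y) < continuum := by
  by_contra! hle
  have : ∀ y : (X \ condensationPoints X : Set Y), ∃ b : countableBasis Y,
      (y : Y) ∈ b.1 ∧ #(b.1 ∩ X : Set Y) < continuum := by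
    intro y
    have hy := y.2.2
    simp only [condensationPoints, mem_ofPred_eq, not_and, not_forall, not_le] at hy
    obtain ⟨U, hU, hyU, hlt⟩ := hy y.2.1
    obtain ⟨b, hb, hyb, hbU⟩ := (isBasis_countableBasis Y).exists_subset_of_mem_open hyU hU
    exact ⟨⟨b, hb⟩, hyb, (mk_le_mk_of_subset (inter_subset_inter_left X hbU)).trans_lt hlt⟩
  choose b hb hlt using this
  have : Countable (countableBasis Y) := (countable_countableBasis Y).to_subtype
  obtain ⟨B, t, ht, hcard, hB⟩ :=
    infinite_pigeonhole_set b continuum hle aleph0_le_continuum mk_lt_cof_continuum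
  obtain ⟨y, hy⟩ := mk_set_ne_zero_iff.1 (aleph0_pos.trans_le (aleph0_le_continuum.trans hcard)).ne'
  have hsub : t ⊆ B.1 ∩ X := fun z hz => ⟨hB hz ▸ hb ⟨z, ht hz⟩, (ht hz).1⟩
  have := hlt ⟨y, ht hy⟩
  rw [hB hy] at this
  exact ((mk_le_mk_of_subset hsub).trans_lt this).not_ge hcard

theorem continuum_le_mk_inter_condensationPoints {Y : Type} [TopologicalSpace Y]
    [SecondCountableTopology Y] {X U : Set Y} (hU : continuum ≤ #(U ∩ X : Set Y)) :
    continuum ≤ #(U ∩ condensationPoints X : Set Y) := by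
  by_contra! hlt
  have hsub : U ∩ X ⊆ (U ∩ condensationPoints X) ∪ (X \ condensationPoints X) := by
    intro y hy
    by_cases h : y ∈ condensationPoints X
    · exact Or.inl ⟨hy.1, h⟩
    · exact Or.inr ⟨hy.2, h⟩
  exact (((mk_le_mk_of_subset hsub).trans (mk_union_le _ _)).trans_lt
    (add_lt_of_lt aleph0_le_continuum hlt (mk_diff_condensationPoints_lt X))).not_ge hU

/-- The autohomeomorphism of the Cantor space that flips all digits at odd places. -/
def twistHomeomorph : (ℕ → Bool) ≃ₜ (ℕ → Bool) where
  toFun := twist true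
  invFun := twist true
  left_inv x := by simp [twist_twist]
  right_inv x := by simp [twist_twist]
  continuous_toFun := continuous_twist true
  continuous_invFun := continuous_twist true

theorem twist_mem_condensationPoints {X : Set (ℕ → Bool)} (hX : ∀ y ∈ X, twist true y ∈ X)
    {y : ℕ → Bool} (hy : y ∈ condensationPoints X) : twist true y ∈ condensationPoints X := by
  refine ⟨hX y hy.1, fun U hU hyU => ?_⟩
  refine (hy.2 _ (hU.preimage (continuous_twist true)) hyU).trans ?_
  refine (mk_le_mk_of_subset fun z hz => ?_).trans
    (mk_preimage_of_injective (twist true) (U ∩ X) (twist_injective true))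
  exact ⟨hz.1, hX z hz.2⟩

theorem exists_isCrowded_isEntangled_homeomorph (h : hm = continuum) :
    ∃ E : Set ℝ, IsCrowded continuum E ∧ IsEntangled continuum E ∧
      ∃ f : E ≃ₜ E, f ≠ Homeomorph.refl E := by
  obtain ⟨X, hX, htw, hent⟩ := exists_isEntangled_of_hm_eq_continuum h
  set X' := condensationPoints X
  have hX' : continuum ≤ #X' := by
    have := continuum_le_mk_inter_condensationPoints (X := X) (U := univ) (by rwa [univ_inter])
    rwa [univ_inter] at this
  have hiff : ∀ y, y ∈ X' ↔ twistHomeomorph y ∈ X' := fun y =>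
    ⟨twist_mem_condensationPoints htw, fun hy => by
      simpa [twistHomeomorph, twist_twist] using twist_mem_condensationPoints htw hy⟩
  let φ : X' ≃ₜ cantorReal '' X' := isEmbedding_cantorReal.homeomorphImage X'
  let τ : X' ≃ₜ X' := twistHomeomorph.subtype hiff
  refine ⟨cantorReal '' X', ?_, ?_, φ.symm.trans (τ.trans φ), fun heq => ?_⟩
  · rintro U hU ⟨_, hyU, y, hy, rfl⟩
    have h1 := continuum_le_mk_inter_condensationPoints
      (hy.2 _ (hU.preimage continuous_cantorReal) hyU)
    rw [← mk_image_eq cantorReal_injective] at h1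
    refine h1.trans (mk_le_mk_of_subset ?_)
    rintro _ ⟨z, hz, rfl⟩
    exact ⟨hz.1, z, hz.2, rfl⟩
  · exact hent _ (image_mono (sep_subset _ _)) (by rwa [mk_image_eq cantorReal_injective])
  · obtain ⟨y, hy⟩ := mk_set_ne_zero_iff.1 (aleph0_pos.trans_le (aleph0_le_continuum.trans hX')).ne'
    have h1 : φ (τ (φ.symm (φ ⟨y, hy⟩))) = φ ⟨y, hy⟩ := DFunLike.congr_fun heq (φ ⟨y, hy⟩)
    rw [φ.symm_apply_apply] at h1
    exact twist_true_ne y (congrArg Subtype.val (φ.injective h1))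

end EntangledOrder

theorem mainTheorem2 :
    -- Under `𝔥𝔪 = 2^ℵ₀` there is a crowded entangled set with a nontrivial autohomeomorphism.
    (EntangledOrder.hm = Cardinal.continuum →
      ∃ E : Set ℝ, EntangledOrder.IsCrowded Cardinal.continuum E ∧
        EntangledOrder.IsEntangled Cardinal.continuum E ∧
        ∃ h : E ≃ₜ E, h ≠ Homeomorph.refl E) ∧
    -- For every infinite `κ`, such a set yields the two homeomorphic sets.
    (∀ κ : Cardinal.{0}, Cardinal.aleph0 ≤ κ →
      (∃ E : Set ℝ, EntangledOrder.IsCrowded κ E ∧ EntangledOrder.IsEntangled κ E ∧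
        ∃ h : E ≃ₜ E, h ≠ Homeomorph.refl E) →
      ∃ A B : Set ℝ, Nonempty (A ≃ₜ B) ∧
        EntangledOrder.IsEntangled κ A ∧ ¬ EntangledOrder.IsEntangledN κ 2 B) ∧
    -- The combination of the two.
    (EntangledOrder.hm = Cardinal.continuum →
      ∃ A B : Set ℝ, Nonempty (A ≃ₜ B) ∧
        EntangledOrder.IsEntangled Cardinal.continuum A ∧
        ¬ EntangledOrder.IsEntangledN Cardinal.continuum 2 B) ∧
    -- The continuum hypothesis implies `𝔥𝔪 = 2^ℵ₀`.
    (Cardinal.continuum.{0} = Cardinal.aleph 1 → EntangledOrder.hm = Cardinal.continuum) ∧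
    -- The case of the continuum hypothesis.
    (Cardinal.continuum.{0} = Cardinal.aleph 1 →
      ∃ A B : Set ℝ, Nonempty (A ≃ₜ B) ∧
        EntangledOrder.IsEntangled (Cardinal.aleph 1) A ∧
        ¬ EntangledOrder.IsEntangledN (Cardinal.aleph 1) 2 B) := by
  have h₂ := fun (κ : Cardinal.{0}) (h : ∃ E : Set ℝ, EntangledOrder.IsCrowded κ E ∧
      EntangledOrder.IsEntangled κ E ∧ ∃ h : E ≃ₜ E, h ≠ Homeomorph.refl E) =>
    let ⟨_, hcr, hent, _, hne⟩ := h
    EntangledOrder.exists_homeomorph_isEntangled_not_isEntangledN hcr hent hne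
  have h₃ := fun h => h₂ _ (EntangledOrder.exists_isCrowded_isEntangled_homeomorph h)
  refine ⟨EntangledOrder.exists_isCrowded_isEntangled_homeomorph, fun κ _ => h₂ κ, h₃,
    EntangledOrder.hm_eq_continuum_of_continuum_eq_aleph_one, fun hCH => ?_⟩
  rw [← hCH]
  exact h₃ (EntangledOrder.hm_eq_continuum_of_continuum_eq_aleph_one hCH)
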